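/- **Theorem 1.1 (Parseval-Rayleigh identities).** Let $k$ be a field of characteristic $p>0$, let $R=k[x_1,\dots,x_m]$ with the standard grading, and let $g_1,\dots,g_m$ be an $R$-regular sequence of homogeneous polynomials. Put $I=(g_1,\dots,g_m)$, let $\pi:R\to R/I$ be the projection, and let $s=-m+\sum_{i=1}^m\deg g_i$. Let $\mathrm{vol}:(R/I)_s\to k$ be the residue map, that is, the $k$-linear isomorphism such that, for every $m\times m$ matrix $N$ over $R$ with $g_i=\sum_{j}N_{ij}x_j$ for all $i$, the class $\pi(\det N)$ lies in $(R/I)_s$ and $\mathrm{vol}(\pi(\det N))=1$; such an isomorphism exists and is unique. Let $\circ$ be the symmetric $k$-bilinear form on $R_i\times R_i$ (for each $i\ge 0$) with $u\circ u'=\delta_{u,u'}$ for monic monomials $u,u'$ of degree $i$. Then for every $w\in R_s$, $$\mathrm{vol}(\pi(w))=\sum_{u\in\mathcal M_s}\Bigl(\bigl(x_1^{p-1}\cdots x_m^{p-1}u^p\bigr)\circ\bigl(g_1^{p-1}\cdots g_m^{p-1}w\bigr)\Bigr)\,\bigl(\mathrm{vol}(\pi(u))\bigr)^p,$$ where $\mathcal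 M_s$ is the set of all monic monomials of degree $s$ in $R$. -/

import Mathlib

open MvPolynomial

namespace ParsevalRayleigh

noncomputable section

variable {k : Type*} [Field k] {m : ℕ}

/-- The ideal `I = (g₁, …, gₘ)` of `R = k[x₁, …, xₘ]`. -/
abbrev idealOf (g : Fin m → MvPolynomial (Fin m) k) : Ideal (MvPolynomial (Fin m) k) :=
  Ideal.span (Set.range g)

/-- The degree `s` component `(R/I)_s` of `R/I`: the image of `R_s` under `π : R → R/I`. -/
def gradedPiece (I : Ideal (MvPolynomial (Fin m) k)) (s : ℕ) :
    Submodule k (MvPolynomial (Fin m) k ⧸ I) :=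
  (homogeneousSubmodule (Fin m) k s).map (Ideal.Quotient.mkₐ k I).toLinearMap

/-- The projection `π : R → R/I` in degree `s`, as a map `R_s → (R/I)_s`. -/
def proj (I : Ideal (MvPolynomial (Fin m) k)) (s : ℕ) :
    homogeneousSubmodule (Fin m) k s →ₗ[k] gradedPiece I s :=
  (Ideal.Quotient.mkₐ k I).toLinearMap.submoduleMap (homogeneousSubmodule (Fin m) k s)

theorem coe_proj (I : Ideal (MvPolynomial (Fin m) k)) (s : ℕ)
    (w : homogeneousSubmodule (Fin m) k s) :
    (proj I s w : MvPolynomial (Fin m) k ⧸ I) = Ideal.Quotient.mk I w := rfl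

/-- `vol : (R/I)_s ≃ k` is the residue map of the sequence `g`: it is a linear isomorphism, and
for every matrix `N` over `R` with `gᵢ = ∑ⱼ Nᵢⱼ xⱼ`, the class `π (det N)` lies in `(R/I)_s` and
has `vol (π (det N)) = 1`. -/
def IsResidueMap (g : Fin m → MvPolynomial (Fin m) k) (s : ℕ)
    (vol : gradedPiece (idealOf g) s ≃ₗ[k] k) : Prop :=
  ∀ N : Matrix (Fin m) (Fin m) (MvPolynomial (Fin m) k),
    g = N.mulVec X →
      ∃ h : Ideal.Quotient.mk (idealOf g) N.det ∈ gradedPiece (idealOf g) s,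
        vol ⟨Ideal.Quotient.mk (idealOf g) N.det, h⟩ = 1

/-- The contraction pairing `f ∘ h`: the bilinear form on `R` for which the monic monomials are
orthonormal. Restricted to `R_i × R_i` it is the form with `u ∘ u' = δ_{u,u'}`
for monic monomials `u, u'` of degree `i`. -/
def contract : LinearMap.BilinForm k (MvPolynomial (Fin m) k) :=
  (basisMonomials (Fin m) k).toDual

theorem contract_monomial (a b : Fin m →₀ ℕ) :
    contract (monomial a (1 : k)) (monomial b 1) = if a = b then 1 else 0 := by
  have h := (basisMonomials (Fin m) k).toDual_apply a b
  simpa only [contract, coe_basisMonomials] using h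

/-- The exponent vectors of the monic monomials of degree `s` in `x₁, …, xₘ`. -/
def exponents (m s : ℕ) : Finset (Fin m →₀ ℕ) :=
  Finset.finsuppAntidiag Finset.univ s

theorem mem_exponents {s : ℕ} {a : Fin m →₀ ℕ} : a ∈ exponents m s ↔ a.degree = s := by
  simp [exponents, Finset.mem_finsuppAntidiag, Finsupp.degree_eq_sum]

/-- The monic monomial `x₁^{a₁} ⋯ xₘ^{aₘ}` as an element of `R_s`, when `∑ aᵢ = s`. -/
def monicMonomial (k : Type*) [Field k] {s : ℕ} (a : exponents m s) :
    homogeneousSubmodule (Fin m) k s :=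
  ⟨monomial a.1 1, isHomogeneous_monomial 1 (mem_exponents.mp a.2)⟩

end

end ParsevalRayleigh

/-!
Write `R = k[x₁, …, xₘ]` and `I = (g₁, …, gₘ)`. Since `g` is a homogeneous regular sequence, the
Hilbert series of `R/I` is `∏ (1 + T + ⋯ + T^{dᵢ-1})` (`finrank_gradedPiece_idealOf`): it has
degree `s` and leading coefficient `1`. So `(R/I)_s` is a line, and all monomials of degree `> s`
lie in `I`. In particular there is a matrix `A` with `x_i^{n+1} = ∑ⱼ Aᵢⱼ gⱼ` for `n = s`.

The residue then has a concrete form: `vol (π w)` is the coefficient of `x₁ⁿ ⋯ xₘⁿ` in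
`det A · w` (`IsResidueMap.apply_proj`), for *every* `n` and every such `A`. Indeed this
coefficient vanishes on `I` by Cramer's rule, and it is `1` at `det N` whenever `g = N x`, because
`A N` and `diag (xᵢⁿ)` both express `(xᵢ^{n+1})` through the variables, and the determinant of such
a matrix is unique modulo the ideal generated by the target sequence (`det_sub_det_mem`, which rests
on the exactness of the Koszul complex of the variables in degree one). This gives the existence
and the uniqueness of the residue map.

The Parseval-Rayleigh identity compares two such expressions. Applying Frobenius to
`x_i^{n+1} = ∑ⱼ Aᵢⱼ gⱼ` gives `x_i^{p(n+1)} = ∑ⱼ (Aᵢⱼ^p gⱼ^{p-1}) gⱼ`, so `vol (π w)` is also the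
coefficient of `∏ xᵢ^{pn+p-1}` in `(det A)^p · ∏ gᵢ^{p-1} · w`. Expanding `(det A)^p` into `p`-th
powers of terms (`coeff_pow_char_mul`) writes this as a sum over the monomials `u` of degree `s` of
the coefficient of `∏ xᵢ^{p-1} · u^p` in `∏ gᵢ^{p-1} · w`, times the `p`-th power of the coefficient
of `∏ xᵢⁿ` in `det A · u`, which is `vol (π u)`.
-/

namespace ParsevalRayleigh

/-! ### Determinants of transition matrices -/

/-- A submodule of `Rᵐ` that contains the Koszul relations `xₐ e_b - x_b eₐ` contains every linear
relation between the variables. -/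
theorem mem_of_dotProduct_X_eq_zero {k : Type*} [CommRing k] [IsDomain k] {m : ℕ}
    (K : Submodule (MvPolynomial (Fin m) k) (Fin m → MvPolynomial (Fin m) k))
    (hK : ∀ a b : Fin m, Pi.single b (X a) - Pi.single a (X b) ∈ K)
    (v : Fin m → MvPolynomial (Fin m) k) (hv : ∑ j, v j * X j = 0) : v ∈ K := by
  suffices H : ∀ (S : Finset (Fin m)) (v : Fin m → MvPolynomial (Fin m) k),
      (∀ j ∉ S, v j = 0) → ∑ j ∈ S, v j * X j = 0 → v ∈ K from
    H Finset.univ v (by simp) hv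
  intro S
  induction S using Finset.induction_on with
  | empty =>
    intro v h0 _
    have : v = 0 := funext fun j => h0 j (by simp)
    exact this ▸ K.zero_mem
  | insert i S hi ih =>
    intro v h0 hsum
    rw [Finset.sum_insert hi] at hsum
    -- The variables in `S` generate a prime ideal that does not contain `xᵢ`,
    -- so it contains `vᵢ`.
    have hmem : v i ∈ Ideal.span (X '' (S : Set (Fin m)) : Set (MvPolynomial (Fin m) k)) := by
      have h1 : v i * X i ∈ Ideal.span (X '' (S : Set (Fin m)) : Set (MvPolynomial (Fin m) k)) := by
        rw [eq_neg_of_add_eq_zero_left hsum]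
        exact neg_mem (sum_mem fun j hj => Ideal.mul_mem_left _ _
          (Ideal.subset_span ⟨j, hj, rfl⟩))
      rw [mem_ideal_span_X_image] at h1 ⊢
      intro c hc
      obtain ⟨j, hj, hne⟩ := h1 (c + Finsupp.single i 1) (by
        rw [mem_support_iff, coeff_mul_X]
        exact mem_support_iff.mp hc)
      have hji : i ≠ j := fun h => hi (h ▸ hj)
      exact ⟨j, hj, by simpa [hji] using hne⟩
    obtain ⟨a, ha⟩ := (Submodule.mem_span_image_finset_iff_exists_fun' _).mp hmem
    set κ : Fin m → MvPolynomial (Fin m) k :=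
      ∑ j ∈ S, a j • (Pi.single i (X j) - Pi.single j (X i)) with hκ
    have hκK : κ ∈ K := sum_mem fun j _ => K.smul_mem _ (hK j i)
    have hκi : κ i = v i := by
      rw [hκ, ← ha, Finset.sum_apply]
      refine Finset.sum_congr rfl fun j hj => ?_
      have hji : i ≠ j := fun h => hi (h ▸ hj)
      simp [hji]
    have hκS : ∀ j ∈ S, κ j = - (a j * X i) := by
      intro j hj
      have hji : j ≠ i := fun h => hi (h ▸ hj)
      rw [hκ, Finset.sum_apply, Finset.sum_eq_single j]
      · simp [hji]
      · intro b _ hb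
        simp [hji, hb.symm]
      · exact fun h => absurd hj h
    have hκ0 : ∀ j, j ≠ i → j ∉ S → κ j = 0 := by
      intro j hji hj
      rw [hκ, Finset.sum_apply]
      refine Finset.sum_eq_zero fun b hb => ?_
      have hjb : j ≠ b := fun h => hj (h ▸ hb)
      simp [hji, hjb]
    have hsub : v - κ ∈ K := by
      refine ih _ (fun j hj => ?_) ?_
      · by_cases hji : j = i
        · subst hji; simp [hκi]
        · simp [h0 j (by simp [hji, hj]), hκ0 j hji hj]
      · rw [← hsum, ← ha, Finset.sum_mul, ← Finset.sum_add_distrib]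
        refine Finset.sum_congr rfl fun j hj => ?_
        rw [Pi.sub_apply, hκS j hj, smul_eq_mul]
        ring
    simpa using add_mem hsub hκK

/-- If row `i` of `M` is replaced by a Koszul relation, the determinant falls into the ideal
generated by the other entries of `M x`. -/
theorem det_updateRow_koszul_mem {R : Type*} [CommRing R] {m : ℕ} (x : Fin m → R)
    (M : Matrix (Fin m) (Fin m) R) (i a b : Fin m) {I : Ideal R}
    (hI : ∀ j ≠ i, M.mulVec x j ∈ I) :
    (M.updateRow i (Pi.single b (x a) - Pi.single a (x b))).det ∈ I := by
  set B := M.updateRow i (Pi.single b 1) with hB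
  have hrow : Pi.single b (x a) - Pi.single a (x b)
      = x a • (Pi.single b 1 : Fin m → R) + (-x b) • Pi.single a 1 := by
    ext j
    simp [Pi.single_apply, sub_eq_add_neg]
  -- Cramer's rule for the matrix `B`, whose product with `x` is `x_b` in row `i`
  -- and lies in `I` in all other rows.
  have hcr : B.det * x a = ∑ j, B.adjugate a j * B.mulVec x j := by
    have h : (B.adjugate * B).mulVec x a = B.det * x a := by
      rw [Matrix.adjugate_mul, Matrix.smul_mulVec, Matrix.one_mulVec]; rfl
    rw [← h, ← Matrix.mulVec_mulVec]; rfl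
  have hadj : B.adjugate a i = (M.updateRow i (Pi.single a 1)).det := by
    rw [Matrix.adjugate_apply, hB, Matrix.updateRow_idem]
  have hBi : B.mulVec x i = x b := by
    simp [hB, Matrix.mulVec, Matrix.updateRow_self]
  rw [hrow, Matrix.det_updateRow_add, Matrix.det_updateRow_smul, Matrix.det_updateRow_smul,
    ← hB, mul_comm, hcr, ← Finset.add_sum_erase _ _ (Finset.mem_univ i), hadj, hBi]
  ring_nf
  refine sum_mem fun j hj => I.mul_mem_left _ ?_
  have hj' : j ≠ i := Finset.ne_of_mem_erase hj
  have : B.mulVec x j = M.mulVec x j := by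
    simp [hB, Matrix.mulVec, Matrix.updateRow_ne hj']
  exact this ▸ hI j hj'

/-- The determinant of a matrix `M` with `M x = g` is determined modulo the ideal generated
by `g`. -/
theorem det_sub_det_mem {k : Type*} [CommRing k] [IsDomain k] {m : ℕ}
    (g : Fin m → MvPolynomial (Fin m) k) (M N : Matrix (Fin m) (Fin m) (MvPolynomial (Fin m) k))
    (hM : g = M.mulVec X) (hN : g = N.mulVec X) :
    N.det - M.det ∈ Ideal.span (Set.range g) := by
  classical
  have key : ∀ (A : Matrix (Fin m) (Fin m) (MvPolynomial (Fin m) k)) (i : Fin m),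
      g = A.mulVec X → (A.updateRow i (N i - M i)).det ∈ Ideal.span (Set.range g) := by
    intro A i hA
    let K : Submodule (MvPolynomial (Fin m) k) (Fin m → MvPolynomial (Fin m) k) :=
      { carrier := {v | (A.updateRow i v).det ∈ Ideal.span (Set.range g)}
        add_mem' := fun {v w} hv hw => by
          simp only [Set.mem_ofPred_eq, Matrix.det_updateRow_add] at *
          exact add_mem hv hw
        zero_mem' := by
          have h : (A.updateRow i 0).det = 0 :=
            Matrix.det_eq_zero_of_row_eq_zero i (by simp)
          simp [h]
        smul_mem' := fun c v hv => by
          simp only [Set.mem_ofPred_eq, Matrix.det_updateRow_smul] at *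
          exact Ideal.mul_mem_left _ _ hv }
    refine mem_of_dotProduct_X_eq_zero K (fun a b => ?_) (N i - M i) ?_
    · change (A.updateRow i (Pi.single b (X a) - Pi.single a (X b))).det ∈ Ideal.span (Set.range g)
      refine det_updateRow_koszul_mem X A i a b fun j _ => ?_
      rw [← hA]
      exact Ideal.subset_span (Set.mem_range_self j)
    · have h : N.mulVec X i - M.mulVec X i = 0 := by rw [← hM, ← hN, sub_self]
      simpa [Matrix.mulVec, dotProduct, sub_mul] using h
  -- Exchange the rows of `M` for those of `N` one at a time.
  let F : Finset (Fin m) → Matrix (Fin m) (Fin m) (MvPolynomial (Fin m) k) :=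
    fun S i => if i ∈ S then N i else M i
  have hFN : F Finset.univ = N := funext fun i => if_pos (Finset.mem_univ i)
  have hFM : F ∅ = M := funext fun i => if_neg (Finset.notMem_empty i)
  suffices H : ∀ S, (F S).det - M.det ∈ Ideal.span (Set.range g) from hFN ▸ H Finset.univ
  intro S
  induction S using Finset.induction_on with
  | empty => simp [hFM]
  | insert i S hi ih =>
    have hAX : g = (F S).mulVec X := by
      funext j
      by_cases hj : j ∈ S
      · rw [hN]; simp [F, Matrix.mulVec, hj]
      · rw [hM]; simp [F, Matrix.mulVec, hj]
    have h1 : F (insert i S) = (F S).updateRow i ((N i - M i) + M i) := by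
      funext j
      by_cases hj : j = i
      · subst hj
        rw [Matrix.updateRow_self, sub_add_cancel]
        exact if_pos (Finset.mem_insert_self j S)
      · rw [Matrix.updateRow_ne hj]
        simp [F, hj]
    have h2 : (F S).updateRow i (M i) = F S := by
      have : M i = F S i := (if_neg hi).symm
      rw [this, Matrix.updateRow_eq_self]
    rw [h1, Matrix.det_updateRow_add, h2, add_sub_assoc]
    exact add_mem (key (F S) i hAX) ih

/-! ### The Hilbert function of a homogeneous complete intersection -/

theorem homogeneousComponent_mul_of_isHomogeneous {k : Type*} [CommRing k] {m : ℕ}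
    {g : MvPolynomial (Fin m) k} {d : ℕ} (hg : g.IsHomogeneous d) (n : ℕ)
    (r : MvPolynomial (Fin m) k) :
    homogeneousComponent n (g * r) = if d ≤ n then g * homogeneousComponent (n - d) r else 0 := by
  let _ : GradedAlgebra (homogeneousSubmodule (Fin m) k) := MvPolynomial.gradedAlgebra
  have h := DirectSum.coe_decompose_mul_of_left_mem (𝒜 := homogeneousSubmodule (Fin m) k)
    (b := r) n hg
  rw [← decomposition.decompose'_apply, ← decomposition.decompose'_apply]
  exact h

/-- An ideal of the polynomial ring is graded if it contains the homogeneous components of its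
elements. -/
def IsGraded {k : Type*} [CommRing k] {m : ℕ} (J : Ideal (MvPolynomial (Fin m) k)) : Prop :=
  ∀ w ∈ J, ∀ n, homogeneousComponent n w ∈ J

theorem isGraded_bot {k : Type*} [CommRing k] {m : ℕ} :
    IsGraded (⊥ : Ideal (MvPolynomial (Fin m) k)) := by
  rintro w rfl n
  simp

theorem IsGraded.sup_span_singleton {k : Type*} [CommRing k] {m : ℕ}
    {J : Ideal (MvPolynomial (Fin m) k)} (hJ : IsGraded J) {g : MvPolynomial (Fin m) k} {d : ℕ}
    (hg : g.IsHomogeneous d) : IsGraded (J ⊔ Ideal.span {g}) := by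
  intro w hw n
  obtain ⟨j, hj, y, hy, rfl⟩ := Submodule.mem_sup.mp hw
  obtain ⟨r, rfl⟩ := Ideal.mem_span_singleton'.mp hy
  rw [map_add, mul_comm, homogeneousComponent_mul_of_isHomogeneous hg]
  refine add_mem (Ideal.mem_sup_left (hJ j hj n)) (Ideal.mem_sup_right ?_)
  split_ifs
  · exact Ideal.mul_mem_right _ _ (Ideal.mem_span_singleton_self g)
  · exact zero_mem _

section Hilbert

variable {k : Type*} [Field k] {m : ℕ}

instance (n : ℕ) : FiniteDimensional k (homogeneousSubmodule (Fin m) k n) :=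
  Module.Finite.iff_fg.mpr (homogeneousSubmodule_fg (Fin m) k n)

instance (J : Ideal (MvPolynomial (Fin m) k)) (n : ℕ) :
    FiniteDimensional k (gradedPiece J n) :=
  Module.Finite.iff_fg.mpr ((homogeneousSubmodule_fg (Fin m) k n).map _)

theorem proj_surjective (J : Ideal (MvPolynomial (Fin m) k)) (n : ℕ) :
    Function.Surjective (proj J n) :=
  LinearMap.submoduleMap_surjective _ _

theorem proj_eq_zero_iff {J : Ideal (MvPolynomial (Fin m) k)} {n : ℕ}
    {w : homogeneousSubmodule (Fin m) k n} :
    proj J n w = 0 ↔ (w : MvPolynomial (Fin m) k) ∈ J := by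
  rw [← Ideal.Quotient.eq_zero_iff_mem, ← coe_proj, ZeroMemClass.coe_eq_zero]

/-- The natural map `(R/J)_n → (R/J')_n` for `J ≤ J'`. -/
noncomputable def gradedFactor {J J' : Ideal (MvPolynomial (Fin m) k)} (h : J ≤ J') (n : ℕ) :
    gradedPiece J n →ₗ[k] gradedPiece J' n :=
  (Ideal.Quotient.factorₐ k h).toLinearMap.restrict (by
    rintro _ ⟨w, hw, rfl⟩
    exact ⟨w, hw, rfl⟩)

theorem gradedFactor_proj {J J' : Ideal (MvPolynomial (Fin m) k)} (h : J ≤ J') (n : ℕ)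
    (w : homogeneousSubmodule (Fin m) k n) : gradedFactor h n (proj J n w) = proj J' n w :=
  rfl

theorem gradedFactor_surjective {J J' : Ideal (MvPolynomial (Fin m) k)} (h : J ≤ J') (n : ℕ) :
    Function.Surjective (gradedFactor h n) := fun y => by
  obtain ⟨w, rfl⟩ := proj_surjective J' n y
  exact ⟨proj J n w, rfl⟩

/-- Multiplication by a form `g` of degree `d`, as a map `R_n → (R/J)_{n+d}`. -/
noncomputable def mulProj (J : Ideal (MvPolynomial (Fin m) k)) {g : MvPolynomial (Fin m) k} {d : ℕ}
    (hg : g.IsHomogeneous d) (n : ℕ) :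
    homogeneousSubmodule (Fin m) k n →ₗ[k] gradedPiece J (n + d) :=
  proj J (n + d) ∘ₗ (LinearMap.mulRight k g).restrict fun _ hw => IsHomogeneous.mul hw hg

/-- The Hilbert series `∑ₙ dim (R/J)_n Tⁿ` of `R/J`. -/
noncomputable def hilbertSeries (J : Ideal (MvPolynomial (Fin m) k)) : PowerSeries ℤ :=
  PowerSeries.mk fun n => (Module.finrank k (gradedPiece J n) : ℤ)

/-- Killing a form of degree `d` that is a nonzerodivisor on `R/J` multiplies the Hilbert series
by `1 - T^d`. -/
theorem hilbertSeries_sup_span_singleton {J : Ideal (MvPolynomial (Fin m) k)} (hJ : IsGraded J)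
    {g : MvPolynomial (Fin m) k} {d : ℕ} (hg : g.IsHomogeneous d)
    (hreg : ∀ r, g * r ∈ J → r ∈ J) :
    hilbertSeries (J ⊔ Ideal.span {g}) = hilbertSeries J * (1 - PowerSeries.X ^ d) := by
  have hle : J ≤ J ⊔ Ideal.span {g} := le_sup_left
  ext n
  rw [mul_sub, mul_one, map_sub, PowerSeries.coeff_mul_X_pow']
  simp only [hilbertSeries, PowerSeries.coeff_mk]
  have hrn := (gradedFactor hle n).finrank_range_add_finrank_ker
  rw [LinearMap.range_eq_top.mpr (gradedFactor_surjective hle n), finrank_top] at hrn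
  rw [← hrn]
  -- A form of degree `n` in `J + (g)` is, in degree `n`, the sum of a form in `J` and a multiple
  -- of `g`.
  have hdecomp : ∀ w : homogeneousSubmodule (Fin m) k n,
      (w : MvPolynomial (Fin m) k) ∈ J ⊔ Ideal.span {g} → ∃ j ∈ J, ∃ r : MvPolynomial (Fin m) k,
        (w : MvPolynomial (Fin m) k) =
          j + if d ≤ n then g * homogeneousComponent (n - d) r else 0 := by
    intro w hw
    obtain ⟨j, hj, y, hy, hjy⟩ := Submodule.mem_sup.mp hw
    obtain ⟨r, rfl⟩ := Ideal.mem_span_singleton'.mp hy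
    refine ⟨homogeneousComponent n j, hJ j hj n, r, ?_⟩
    rw [← homogeneousComponent_mul_of_isHomogeneous hg, ← map_add, mul_comm, hjy,
      homogeneousComponent_eq_self w.2]
  split_ifs with hdn
  · obtain ⟨e, rfl⟩ := Nat.exists_eq_add_of_le' hdn
    rw [Nat.add_sub_cancel] at *
    have hker : LinearMap.ker (gradedFactor hle (e + d)) = LinearMap.range (mulProj J hg e) := by
      ext x
      constructor
      · intro hx
        obtain ⟨w, rfl⟩ := proj_surjective J _ x
        rw [LinearMap.mem_ker, gradedFactor_proj, proj_eq_zero_iff] at hx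
        obtain ⟨j, hj, r, hw⟩ := hdecomp w hx
        rw [if_pos hdn] at hw
        refine ⟨⟨homogeneousComponent e r, homogeneousComponent_mem e r⟩, ?_⟩
        refine (sub_eq_zero.mp ?_).symm
        rw [mulProj, LinearMap.comp_apply, ← map_sub, proj_eq_zero_iff]
        change (w : MvPolynomial (Fin m) k) - homogeneousComponent e r * g ∈ J
        rwa [hw, mul_comm g, add_sub_cancel_right]
      · rintro ⟨r, rfl⟩
        rw [LinearMap.mem_ker, mulProj, LinearMap.comp_apply, gradedFactor_proj, proj_eq_zero_iff]
        exact Ideal.mem_sup_right (Ideal.mul_mem_left _ _ (Ideal.mem_span_singleton_self g))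
    have hker' : LinearMap.ker (mulProj J hg e) = LinearMap.ker (proj J e) := by
      ext r
      rw [LinearMap.mem_ker, LinearMap.mem_ker, mulProj, LinearMap.comp_apply, proj_eq_zero_iff,
        proj_eq_zero_iff]
      refine ⟨fun h => hreg _ ?_, fun h => Ideal.mul_mem_right _ _ h⟩
      rw [mul_comm]
      exact h
    have h1 := (mulProj J hg e).finrank_range_add_finrank_ker
    have h2 := (proj J e).finrank_range_add_finrank_ker
    rw [LinearMap.range_eq_top.mpr (proj_surjective J e), finrank_top] at h2
    rw [hker] at *
    rw [hker'] at h1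
    omega
  · have hker : LinearMap.ker (gradedFactor hle n) = ⊥ := by
      refine (Submodule.eq_bot_iff _).mpr fun x hx => ?_
      obtain ⟨w, rfl⟩ := proj_surjective J _ x
      rw [LinearMap.mem_ker, gradedFactor_proj, proj_eq_zero_iff] at hx
      obtain ⟨j, hj, r, hw⟩ := hdecomp w hx
      rw [if_neg hdn, add_zero] at hw
      exact proj_eq_zero_iff.mpr (hw ▸ hj)
    rw [hker]
    simp

theorem finrank_homogeneousSubmodule (n : ℕ) :
    Module.finrank k (homogeneousSubmodule (Fin m) k n) = (exponents m n).card := by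
  have h : ((exponents m n : Finset (Fin m →₀ ℕ)) : Set (Fin m →₀ ℕ)) = {c | c.degree = n} := by
    ext c
    simp [mem_exponents]
  rw [homogeneousSubmodule_eq_finsupp_supported, ← h,
    (AddMonoidAlgebra.supportedEquivFinsupp _).finrank_eq]
  simp

theorem hilbertSeries_bot :
    hilbertSeries (⊥ : Ideal (MvPolynomial (Fin m) k)) = ∏ _i : Fin m, PowerSeries.mk 1 := by
  ext n
  have hinj : Function.Injective (proj (⊥ : Ideal (MvPolynomial (Fin m) k)) n) := by
    refine (injective_iff_map_eq_zero _).mpr fun w hw => ?_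
    exact Subtype.ext ((Submodule.mem_bot _).mp (proj_eq_zero_iff.mp hw))
  have hfin := (LinearEquiv.ofBijective _ ⟨hinj, proj_surjective _ n⟩).finrank_eq
  rw [PowerSeries.coeff_prod, hilbertSeries, PowerSeries.coeff_mk, ← hfin,
    finrank_homogeneousSubmodule, exponents]
  simp

theorem hilbertSeries_eq_prod {g : Fin m → MvPolynomial (Fin m) k} {d : Fin m → ℕ}
    (hg : ∀ i, (g i).IsHomogeneous (d i))
    (hreg : RingTheory.Sequence.IsWeaklyRegular (MvPolynomial (Fin m) k) (List.ofFn g)) :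
    hilbertSeries (idealOf g) = ∏ i, (PowerSeries.mk 1 * (1 - PowerSeries.X ^ d i)) := by
  have H : ∀ (i : ℕ) (hi : i ≤ m),
      IsGraded (Ideal.ofList ((List.ofFn g).take i)) ∧
      hilbertSeries (Ideal.ofList ((List.ofFn g).take i)) =
        (∏ _i : Fin m, PowerSeries.mk 1) *
          ∏ j : Fin i, (1 - PowerSeries.X ^ d (Fin.castLE hi j)) := by
    intro i
    induction i with
    | zero => intro _; simp [isGraded_bot, hilbertSeries_bot]
    | succ i ih =>
      intro hi
      obtain ⟨h1, h2⟩ := ih (by omega)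
      have hlt : i < (List.ofFn g).length := by simpa using hi
      have htake : Ideal.ofList ((List.ofFn g).take (i + 1)) =
          Ideal.ofList ((List.ofFn g).take i) ⊔ Ideal.span {g ⟨i, hi⟩} := by
        rw [← List.take_concat_get' _ _ hlt, Ideal.ofList_append, Ideal.ofList_singleton]
        simp
      have hr := hreg.regular_mod_prev i hlt
      rw [htake]
      refine ⟨h1.sup_span_singleton (hg _), ?_⟩
      rw [hilbertSeries_sup_span_singleton h1 (hg _), h2, Fin.prod_univ_castSucc, mul_assoc]
      · rfl
      · intro r hgr
        have h0 : (Submodule.Quotient.mk r : MvPolynomial (Fin m) k ⧸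
            (Ideal.ofList ((List.ofFn g).take i) • ⊤ :
              Submodule (MvPolynomial (Fin m) k) (MvPolynomial (Fin m) k))) = 0 := by
          refine hr.right_eq_zero_of_smul ?_
          rw [← Submodule.Quotient.mk_smul, Submodule.Quotient.mk_eq_zero]
          simpa using hgr
        rw [Submodule.Quotient.mk_eq_zero] at h0
        simpa using h0
  have h := (H m le_rfl).2
  have hI : Ideal.ofList ((List.ofFn g).take m) = idealOf g := by
    rw [List.take_of_length_le (by simp)]
    simp [Ideal.ofList, List.mem_ofFn, Set.range, idealOf]
  rw [hI] at h
  rw [h, Finset.prod_mul_distrib]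
  rfl

/-- The Hilbert function of a homogeneous complete intersection takes the value `1` in degree
`s = ∑ dᵢ - m` and vanishes in all higher degrees. -/
theorem finrank_gradedPiece_idealOf {g : Fin m → MvPolynomial (Fin m) k} {d : Fin m → ℕ}
    (hg : ∀ i, (g i).IsHomogeneous (d i))
    (hreg : RingTheory.Sequence.IsWeaklyRegular (MvPolynomial (Fin m) k) (List.ofFn g))
    (hd : ∀ i, d i ≠ 0) {s : ℕ} (hs : s + m = ∑ i, d i) :
    Module.finrank k (gradedPiece (idealOf g) s) = 1 ∧
      ∀ n, s < n → Module.finrank k (gradedPiece (idealOf g) n) = 0 := by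
  set P : Polynomial ℤ := ∏ i, ∑ j ∈ Finset.range (d i), Polynomial.X ^ j with hP
  have hmonic : ∀ i, (∑ j ∈ Finset.range (d i), (Polynomial.X : Polynomial ℤ) ^ j).Monic :=
    fun i => Polynomial.monic_geom_sum_X (hd i)
  have hdeg : ∀ i, (∑ j ∈ Finset.range (d i), (Polynomial.X : Polynomial ℤ) ^ j).natDegree + 1
      = d i := by
    intro i
    have h := congrArg Polynomial.natDegree (geom_sum_mul (Polynomial.X : Polynomial ℤ) (d i))
    rwa [← Polynomial.C_1, (hmonic i).natDegree_mul (Polynomial.monic_X_sub_C 1),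
      Polynomial.natDegree_X_sub_C, Polynomial.natDegree_X_pow_sub_C] at h
  have hPdeg : P.natDegree = s := by
    rw [hP, Polynomial.natDegree_prod_of_monic _ _ fun i _ => hmonic i]
    have h : ∑ i, ((∑ j ∈ Finset.range (d i), (Polynomial.X : Polynomial ℤ) ^ j).natDegree + 1)
        = ∑ i, d i := Finset.sum_congr rfl fun i _ => hdeg i
    rw [Finset.sum_add_distrib] at h
    simp only [Finset.sum_const, Finset.card_univ, Fintype.card_fin, smul_eq_mul, mul_one] at h
    omega
  have hPmonic : P.Monic := Polynomial.monic_prod_of_monic _ _ fun i _ => hmonic i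
  have hseries : hilbertSeries (idealOf g) = (P : PowerSeries ℤ) := by
    rw [hilbertSeries_eq_prod hg hreg, hP, ← Polynomial.coeToPowerSeries.ringHom_apply, map_prod]
    refine Finset.prod_congr rfl fun i _ => ?_
    rw [map_sum]
    simp only [map_pow, Polynomial.coeToPowerSeries.ringHom_apply, Polynomial.coe_X]
    rw [← mul_neg_geom_sum, ← mul_assoc, PowerSeries.mk_one_mul_one_sub_eq_one, one_mul]
  have hcoeff : ∀ n, (Module.finrank k (gradedPiece (idealOf g) n) : ℤ) = P.coeff n := by
    intro n
    rw [← Polynomial.coeff_coe, ← hseries, hilbertSeries, PowerSeries.coeff_mk]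
  constructor
  · have h := hcoeff s
    rw [← hPdeg, hPmonic.coeff_natDegree] at h
    rw [← hPdeg]
    exact_mod_cast h
  · intro n hn
    have h := hcoeff n
    rw [Polynomial.coeff_eq_zero_of_natDegree_lt (hPdeg ▸ hn)] at h
    exact_mod_cast h

end Hilbert

section Residue

variable {k : Type*} [Field k] {m : ℕ}

/-! ### Matrices expressing the sequence through the variables and conversely -/

theorem degree_ne_zero_of_isRegular {g : Fin m → MvPolynomial (Fin m) k} {d : Fin m → ℕ}
    (hg : ∀ i, (g i).IsHomogeneous (d i))
    (hreg : RingTheory.Sequence.IsRegular (MvPolynomial (Fin m) k) (List.ofFn g)) (i : Fin m) :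
    d i ≠ 0 := by
  intro h0
  have htop : Ideal.ofList (List.ofFn g) ≠ ⊤ := fun h => hreg.top_ne_smul (by simp [h])
  have hC := (totalDegree_zero_iff_isHomogeneous (p := g i)).mpr (h0 ▸ hg i)
  rw [totalDegree_eq_zero_iff_eq_C] at hC
  have hmem : g i ∈ Ideal.ofList (List.ofFn g) :=
    Ideal.subset_span (List.mem_ofFn.mpr ⟨i, rfl⟩)
  by_cases hc : coeff 0 (g i) = 0
  · rw [hc, C_0] at hC
    have hlt : (i : ℕ) < (List.ofFn g).length := by simp
    have hr := hreg.regular_mod_prev i hlt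
    have h1 : (Submodule.Quotient.mk 1 : MvPolynomial (Fin m) k ⧸
        (Ideal.ofList ((List.ofFn g).take i) • ⊤ :
          Submodule (MvPolynomial (Fin m) k) (MvPolynomial (Fin m) k))) = 0 :=
      hr.right_eq_zero_of_smul (by simp [hC])
    rw [Submodule.Quotient.mk_eq_zero] at h1
    refine htop ((Ideal.eq_top_iff_one _).mpr (Ideal.span_mono ?_ (by simpa using h1)))
    exact fun r hr => List.mem_of_mem_take hr
  · refine htop (Ideal.eq_top_of_isUnit_mem _ hmem ?_)
    rw [hC]
    exact (isUnit_iff_ne_zero.mpr hc).map C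

/-- Forms of positive degree are combinations of the variables with homogeneous coefficients. -/
theorem exists_homogeneous_mulVec_X {g : Fin m → MvPolynomial (Fin m) k} {d : Fin m → ℕ}
    (hg : ∀ i, (g i).IsHomogeneous (d i)) (hd : ∀ i, d i ≠ 0) :
    ∃ N : Matrix (Fin m) (Fin m) (MvPolynomial (Fin m) k),
      g = N.mulVec X ∧ ∀ i j, (N i j).IsHomogeneous (d i - 1) := by
  have h : ∀ i, ∃ c : Fin m → MvPolynomial (Fin m) k, ∑ j, c j * X j = g i := by
    intro i
    rw [← Ideal.mem_span_range_iff_exists_fun, ← Set.image_univ, mem_ideal_span_X_image]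
    intro c hc
    by_contra! h0
    have hc0 : c = 0 := Finsupp.ext fun j => h0 j (Set.mem_univ j)
    refine hd i ?_
    rw [← (hg i) (mem_support_iff.mp hc), hc0]
    simp
  choose c hc using h
  refine ⟨fun i j => homogeneousComponent (d i - 1) (c i j), ?_,
    fun i j => homogeneousComponent_isHomogeneous _ _⟩
  funext i
  have h1 := congrArg (homogeneousComponent (d i)) (hc i)
  rw [map_sum, homogeneousComponent_eq_self (hg i)] at h1
  rw [← h1]
  refine Finset.sum_congr rfl fun j _ => ?_
  rw [mul_comm, homogeneousComponent_mul_of_isHomogeneous (isHomogeneous_X k j),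
    if_pos (Nat.one_le_iff_ne_zero.mpr (hd i)), mul_comm]

theorem isHomogeneous_det {N : Matrix (Fin m) (Fin m) (MvPolynomial (Fin m) k)} {e : Fin m → ℕ}
    (hN : ∀ i j, (N i j).IsHomogeneous (e i)) : N.det.IsHomogeneous (∑ i, e i) := by
  rw [← Matrix.det_transpose, Matrix.det_apply]
  refine IsHomogeneous.sum _ _ _ fun σ _ => ?_
  rw [Units.smul_def, ← mem_homogeneousSubmodule]
  exact zsmul_mem (IsHomogeneous.prod _ _ _ fun i _ => hN i (σ i)) _

/-! ### The residue as a coefficient -/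

/-- The exponent vector `(n, …, n)`. -/
noncomputable def constExponent (m n : ℕ) : Fin m →₀ ℕ :=
  Finsupp.equivFunOnFinite.symm fun _ => n

@[simp]
theorem constExponent_apply (n : ℕ) (i : Fin m) : constExponent m n i = n := rfl

theorem prod_X_pow_eq_monomial_constExponent (n : ℕ) :
    ∏ i : Fin m, (X i : MvPolynomial (Fin m) k) ^ n = monomial (constExponent m n) 1 := by
  rw [monomial_eq, Finsupp.prod_fintype _ _ (by simp)]
  simp

theorem coeff_eq_zero_of_mem_span_X_pow {n : ℕ} {f : MvPolynomial (Fin m) k}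
    (hf : f ∈ idealOf fun i : Fin m => (X i : MvPolynomial (Fin m) k) ^ (n + 1)) :
    coeff (constExponent m n) f = 0 := by
  obtain ⟨c, rfl⟩ := Ideal.mem_span_range_iff_exists_fun.mp hf
  rw [coeff_sum]
  refine Finset.sum_eq_zero fun i _ => ?_
  rw [X_pow_eq_monomial, coeff_mul_monomial', if_neg]
  intro h
  have := h i
  simp at this

/-- If `x_i^{n+1} = ∑ⱼ Aᵢⱼ gⱼ`, then `f ↦ [x₁ⁿ ⋯ xₘⁿ] (det A · f)` vanishes on the ideal
generated by `g`. -/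
theorem coeff_det_mul_eq_zero {g : Fin m → MvPolynomial (Fin m) k} {n : ℕ}
    {A : Matrix (Fin m) (Fin m) (MvPolynomial (Fin m) k)}
    (hA : (fun i => X i ^ (n + 1)) = A.mulVec g) {f : MvPolynomial (Fin m) k}
    (hf : f ∈ idealOf g) : coeff (constExponent m n) (A.det * f) = 0 := by
  obtain ⟨c, rfl⟩ := Ideal.mem_span_range_iff_exists_fun.mp hf
  refine coeff_eq_zero_of_mem_span_X_pow ?_
  rw [Finset.mul_sum]
  refine Ideal.sum_mem _ fun j _ => ?_
  -- Cramer's rule: `det A · gⱼ` is the `j`-th entry of `adj A · (A g)`.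
  have h : A.det * g j = A.adjugate.mulVec (fun i => X i ^ (n + 1)) j := by
    rw [hA, Matrix.mulVec_mulVec, Matrix.adjugate_mul, Matrix.smul_mulVec, Matrix.one_mulVec]
    rfl
  rw [mul_left_comm, h]
  exact Ideal.mul_mem_left _ _ (Ideal.mem_span_range_iff_exists_fun.mpr ⟨A.adjugate j, rfl⟩)

/-- The functional of `coeff_det_mul_eq_zero` takes the value `1` at the determinant of every
matrix expressing `g` through the variables. -/
theorem coeff_det_mul_det {g : Fin m → MvPolynomial (Fin m) k} {n : ℕ}
    {A N : Matrix (Fin m) (Fin m) (MvPolynomial (Fin m) k)}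
    (hA : (fun i => X i ^ (n + 1)) = A.mulVec g) (hN : g = N.mulVec X) :
    coeff (constExponent m n) (A.det * N.det) = 1 := by
  -- Both `A N` and the diagonal matrix with entries `xᵢⁿ` express `xᵢ^{n+1}` through the variables.
  have h1 : (fun i : Fin m => (X i : MvPolynomial (Fin m) k) ^ (n + 1)) = (A * N).mulVec X := by
    rw [hA, hN, Matrix.mulVec_mulVec]
  have h2 : (fun i : Fin m => (X i : MvPolynomial (Fin m) k) ^ (n + 1)) =
      (Matrix.diagonal fun i => X i ^ n).mulVec X := by
    funext i
    rw [Matrix.mulVec_diagonal, pow_succ]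
  have h := coeff_eq_zero_of_mem_span_X_pow (det_sub_det_mem _ _ _ h2 h1)
  rw [coeff_sub, sub_eq_zero, Matrix.det_mul, Matrix.det_diagonal] at h
  rw [h]
  rw [prod_X_pow_eq_monomial_constExponent, coeff_monomial, if_pos rfl]

/-- The residue map is given by `vol (π w) = [x₁ⁿ ⋯ xₘⁿ] (det A · w)` whenever
`x_i^{n+1} = ∑ⱼ Aᵢⱼ gⱼ`. -/
theorem IsResidueMap.apply_proj {g : Fin m → MvPolynomial (Fin m) k} {s : ℕ}
    {vol : gradedPiece (idealOf g) s ≃ₗ[k] k} (hvol : IsResidueMap g s vol)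
    {N : Matrix (Fin m) (Fin m) (MvPolynomial (Fin m) k)} (hN : g = N.mulVec X) {n : ℕ}
    {A : Matrix (Fin m) (Fin m) (MvPolynomial (Fin m) k)}
    (hA : (fun i => X i ^ (n + 1)) = A.mulVec g) (w : homogeneousSubmodule (Fin m) k s) :
    vol (proj (idealOf g) s w) = coeff (constExponent m n) (A.det * (w : MvPolynomial (Fin m) k)) := by
  obtain ⟨hmem, h1⟩ := hvol N hN
  set c := vol (proj (idealOf g) s w) with hc
  have heq : proj (idealOf g) s w = c • ⟨_, hmem⟩ :=
    vol.injective (by rw [map_smul, h1, smul_eq_mul, mul_one])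
  have hI : (w : MvPolynomial (Fin m) k) - C c * N.det ∈ idealOf g := by
    rw [← Ideal.Quotient.eq_zero_iff_mem, map_sub, sub_eq_zero, ← coe_proj, heq, ← smul_eq_C_mul]
    rfl
  have h := coeff_det_mul_eq_zero hA hI
  rw [mul_sub, mul_left_comm, coeff_sub, coeff_C_mul, coeff_det_mul_det hA hN, mul_one,
    sub_eq_zero] at h
  exact h.symm

theorem exists_mulVec_eq_X_pow {g : Fin m → MvPolynomial (Fin m) k} {n : ℕ}
    (h : Module.finrank k (gradedPiece (idealOf g) (n + 1)) = 0) :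
    ∃ A : Matrix (Fin m) (Fin m) (MvPolynomial (Fin m) k),
      (fun i => X i ^ (n + 1)) = A.mulVec g := by
  have hsub := Module.finrank_zero_iff.mp h
  have hX : ∀ i : Fin m, ∃ c : Fin m → MvPolynomial (Fin m) k,
      ∑ j, c j * g j = X i ^ (n + 1) := fun i => by
    rw [← Ideal.mem_span_range_iff_exists_fun]
    exact proj_eq_zero_iff (w := ⟨X i ^ (n + 1), isHomogeneous_X_pow i (n + 1)⟩).mp
      (Subsingleton.elim _ _)
  choose c hc using hX
  exact ⟨c, funext fun i => (hc i).symm⟩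

theorem existsUnique_isResidueMap {g : Fin m → MvPolynomial (Fin m) k} {s : ℕ}
    (hone : Module.finrank k (gradedPiece (idealOf g) s) = 1)
    {N : Matrix (Fin m) (Fin m) (MvPolynomial (Fin m) k)} (hN : g = N.mulVec X)
    (hNs : N.det.IsHomogeneous s) {n : ℕ}
    {A : Matrix (Fin m) (Fin m) (MvPolynomial (Fin m) k)}
    (hA : (fun i => X i ^ (n + 1)) = A.mulVec g) :
    ∃! vol : gradedPiece (idealOf g) s ≃ₗ[k] k, IsResidueMap g s vol := by
  set D : gradedPiece (idealOf g) s := proj (idealOf g) s ⟨N.det, hNs⟩ with hD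
  have hD0 : D ≠ 0 := by
    intro h
    have h0 := coeff_det_mul_eq_zero hA (proj_eq_zero_iff.mp h)
    rw [coeff_det_mul_det hA hN] at h0
    exact one_ne_zero h0
  let e : gradedPiece (idealOf g) s ≃ₗ[k] k :=
    LinearEquiv.ofFinrankEq _ _ (by rw [hone, Module.finrank_self])
  have he : e D ≠ 0 := fun h => hD0 (e.map_eq_zero_iff.mp h)
  set vol := e ≪≫ₗ LinearEquiv.smulOfNeZero k k (e D)⁻¹ (inv_ne_zero he) with hv
  have hvol : IsResidueMap g s vol := by
    intro M hM
    have hMD : Ideal.Quotient.mk (idealOf g) M.det = D := by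
      rw [hD, coe_proj, ← sub_eq_zero, ← map_sub, Ideal.Quotient.eq_zero_iff_mem]
      exact det_sub_det_mem g N M hN hM
    refine ⟨hMD ▸ D.2, ?_⟩
    have h : (⟨_, hMD ▸ D.2⟩ : gradedPiece (idealOf g) s) = D := Subtype.ext hMD
    rw [h]
    simp [hv, he]
  refine ⟨vol, hvol, fun vol' hvol' => LinearEquiv.ext fun y => ?_⟩
  obtain ⟨w, rfl⟩ := proj_surjective _ _ y
  rw [hvol.apply_proj hN hA, hvol'.apply_proj hN hA]

end Residue

section Frobenius

variable {k : Type*} [Field k] {m : ℕ}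

/-! ### The Frobenius expansion -/

theorem contract_monomial_left (b : Fin m →₀ ℕ) (f : MvPolynomial (Fin m) k) :
    contract (monomial b 1) f = coeff b f := by
  induction f using MvPolynomial.induction_on' with
  | monomial c r =>
    have h : monomial c r = r • monomial c (1 : k) := by rw [smul_monomial, smul_eq_mul, mul_one]
    rw [coeff_monomial, h, map_smul, contract_monomial]
    simp [eq_comm]
  | add f f' hf hf' => rw [map_add, hf, hf', coeff_add]

/-- The coefficient of `x₁^{pn+p-1} ⋯ xₘ^{pn+p-1}` in `q^p f`, sorted by the exponents of the
terms of `f` that contribute to it. -/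
theorem coeff_pow_char_mul {p : ℕ} (hp : 0 < p) [CharP k p] (n s : ℕ) (q : MvPolynomial (Fin m) k)
    {f : MvPolynomial (Fin m) k} (hf : f.IsHomogeneous (m * (p - 1) + p * s)) :
    coeff (constExponent m (p * n + (p - 1))) (q ^ p * f) =
      ∑ a : exponents m s, coeff (constExponent m (p - 1) + p • a.1) f *
        coeff (constExponent m n) (q * monomial a.1 1) ^ p := by
  have : Fact p.Prime := ⟨(CharP.char_is_prime_or_zero k p).resolve_right hp.ne'⟩
  have : ExpChar k p := ExpChar.prime Fact.out
  -- Both sides are additive in `q`, so `q` may be taken to be a single term.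
  induction q using MvPolynomial.induction_on' with
  | add q q' hq hq' =>
    rw [add_pow_char, add_mul, coeff_add, hq, hq',
      ← Finset.sum_add_distrib]
    refine Finset.sum_congr rfl fun a _ => ?_
    rw [add_mul, coeff_add, add_pow_char, mul_add]
  | monomial c r =>
    simp only [monomial_pow, coeff_monomial_mul', monomial_mul, mul_one, coeff_monomial]
    by_cases hc : c ≤ constExponent m n
    · obtain ⟨a, ha⟩ := exists_add_of_le hc
      have hpc : constExponent m (p * n + (p - 1)) =
          p • c + (constExponent m (p - 1) + p • a) := by
        ext i
        have := DFunLike.congr_fun ha i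
        simp only [constExponent_apply, Finsupp.add_apply, Finsupp.smul_apply, smul_eq_mul]
          at this ⊢
        rw [this]
        ring
      rw [if_pos (hpc ▸ le_self_add), hpc, add_tsub_cancel_left]
      by_cases has : a ∈ exponents m s
      · rw [Finset.sum_eq_single ⟨a, has⟩]
        · rw [if_pos ha.symm, mul_comm]
        · intro b _ hb
          rw [if_neg, zero_pow hp.ne', mul_zero]
          intro h
          exact hb (Subtype.ext (add_left_cancel (h.trans ha)))
        · simp
      · rw [hf.coeff_eq_zero, mul_zero]
        · refine (Finset.sum_eq_zero fun b _ => ?_).symm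
          rw [if_neg, zero_pow hp.ne', mul_zero]
          intro h
          exact has (add_left_cancel (h.trans ha) ▸ b.2)
        · intro h
          refine has (mem_exponents.mpr ?_)
          have hdeg : (constExponent m (p - 1)).degree = m * (p - 1) := by
            simp [Finsupp.degree_eq_sum]
          rw [map_add, map_nsmul, hdeg, smul_eq_mul] at h
          exact Nat.eq_of_mul_eq_mul_left hp (Nat.add_left_cancel h)
    · rw [if_neg]
      · refine (Finset.sum_eq_zero fun b _ => ?_).symm
        rw [if_neg, zero_pow hp.ne', mul_zero]
        exact fun h => hc (h ▸ le_self_add)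
      · refine fun h => hc fun i => ?_
        have := h i
        simp only [constExponent_apply, Finsupp.smul_apply, smul_eq_mul] at this ⊢
        by_contra! hlt
        have := Nat.mul_le_mul_left p (Nat.succ_le_of_lt hlt)
        rw [Nat.mul_succ] at this
        omega

/-- If `A` expresses `x_i^{n+1}` through `g`, then the matrix with entries `Aᵢⱼ^p gⱼ^{p-1}`
expresses `x_i^{p(n+1)}` through `g`. -/
theorem X_pow_eq_frobenius_mulVec {p : ℕ} (hp : 0 < p) [CharP k p]
    [ExpChar (MvPolynomial (Fin m) k) p] {g : Fin m → MvPolynomial (Fin m) k}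
    {n : ℕ} {A : Matrix (Fin m) (Fin m) (MvPolynomial (Fin m) k)}
    (hA : (fun i => X i ^ (n + 1)) = A.mulVec g) :
    (fun i => X i ^ (p * n + (p - 1) + 1)) =
      (A.map (frobenius (MvPolynomial (Fin m) k) p) *
        Matrix.diagonal fun j => g j ^ (p - 1)).mulVec g := by
  funext i
  have h := congrArg (frobenius (MvPolynomial (Fin m) k) p) (congrFun hA i)
  have hpn : p * n + (p - 1) + 1 = (n + 1) * p := by
    rw [add_assoc, Nat.sub_add_cancel hp]; ring
  rw [hpn, pow_mul, ← frobenius_def, h, ← Matrix.mulVec_mulVec]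
  simp only [Matrix.mulVec, dotProduct, map_sum, map_mul]
  refine Finset.sum_congr rfl fun j _ => ?_
  have hd := Matrix.mulVec_diagonal (fun j => g j ^ (p - 1)) g j
  simp only [Matrix.mulVec, dotProduct] at hd
  rw [hd, ← pow_succ, Nat.sub_add_cancel hp, frobenius_def p (g j)]
  rfl

end Frobenius

end ParsevalRayleigh

/-! ### The Parseval-Rayleigh identity -/

open ParsevalRayleigh in
theorem theorem1p1 {k : Type*} [Field k] (p : ℕ) (hp : 0 < p) [CharP k p]
    (m : ℕ) (g : Fin m → MvPolynomial (Fin m) k) (d : Fin m → ℕ)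
    (hg : ∀ i, (g i).IsHomogeneous (d i))
    (hreg : RingTheory.Sequence.IsRegular (MvPolynomial (Fin m) k) (List.ofFn g))
    (s : ℕ) (hs : s + m = ∑ i, d i) :
    (∃! vol : ParsevalRayleigh.gradedPiece (ParsevalRayleigh.idealOf g) s ≃ₗ[k] k,
      ParsevalRayleigh.IsResidueMap g s vol) ∧
    ∀ vol : ParsevalRayleigh.gradedPiece (ParsevalRayleigh.idealOf g) s ≃ₗ[k] k,
      ParsevalRayleigh.IsResidueMap g s vol →
      ∀ w : MvPolynomial.homogeneousSubmodule (Fin m) k s,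
        vol (ParsevalRayleigh.proj (ParsevalRayleigh.idealOf g) s w) =
          ∑ a : ParsevalRayleigh.exponents m s,
            ParsevalRayleigh.contract
                ((∏ i, MvPolynomial.X i ^ (p - 1)) *
                  (ParsevalRayleigh.monicMonomial k a : MvPolynomial (Fin m) k) ^ p)
                ((∏ i, g i ^ (p - 1)) * (w : MvPolynomial (Fin m) k)) *
              vol (ParsevalRayleigh.proj (ParsevalRayleigh.idealOf g) s
                (ParsevalRayleigh.monicMonomial k a)) ^ p := by
  have hd := degree_ne_zero_of_isRegular hg hreg
  obtain ⟨hone, hzero⟩ := finrank_gradedPiece_idealOf hg hreg.toIsWeaklyRegular hd hs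
  obtain ⟨A, hA⟩ := exists_mulVec_eq_X_pow (hzero (s + 1) (Nat.lt_succ_self s))
  obtain ⟨N, hN, hNhom⟩ := exists_homogeneous_mulVec_X hg hd
  have hsum : ∑ i, (d i - 1) = s := by
    have h : ∑ i, (d i - 1 + 1) = ∑ i, d i :=
      Finset.sum_congr rfl fun i _ => Nat.sub_add_cancel (Nat.one_le_iff_ne_zero.mpr (hd i))
    rw [Finset.sum_add_distrib] at h
    simp only [Finset.sum_const, Finset.card_univ, Fintype.card_fin, smul_eq_mul, mul_one] at h
    omega
  refine ⟨existsUnique_isResidueMap hone hN (hsum ▸ isHomogeneous_det hNhom) hA,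
    fun vol hvol w => ?_⟩
  have : Fact p.Prime := ⟨(CharP.char_is_prime_or_zero k p).resolve_right hp.ne'⟩
  have : ExpChar (MvPolynomial (Fin m) k) p := ExpChar.prime Fact.out
  have hf : ((∏ i, g i ^ (p - 1)) * (w : MvPolynomial (Fin m) k)).IsHomogeneous
      (m * (p - 1) + p * s) := by
    have h := (IsHomogeneous.prod Finset.univ _ _ fun i _ => (hg i).pow (p - 1)).mul w.2
    rw [← Finset.sum_mul, ← hs] at h
    convert h using 1
    obtain ⟨q, rfl⟩ := Nat.exists_eq_add_of_le' hp
    rw [Nat.add_sub_cancel]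
    ring
  have hdet : (A.map (frobenius (MvPolynomial (Fin m) k) p) *
      Matrix.diagonal fun j => g j ^ (p - 1)).det = A.det ^ p * ∏ i, g i ^ (p - 1) := by
    rw [Matrix.det_mul, Matrix.det_diagonal, ← RingHom.mapMatrix_apply, ← RingHom.map_det,
      frobenius_def]
  rw [hvol.apply_proj hN (X_pow_eq_frobenius_mulVec hp hA), hdet, mul_assoc,
    coeff_pow_char_mul hp s s A.det hf]
  refine Finset.sum_congr rfl fun a _ => ?_
  rw [hvol.apply_proj hN hA]
  congr 1
  have hmon : (∏ i, X i ^ (p - 1)) * (monicMonomial k a : MvPolynomial (Fin m) k) ^ p =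
      monomial (constExponent m (p - 1) + p • a.1) 1 := by
    rw [prod_X_pow_eq_monomial_constExponent, monicMonomial, monomial_pow, one_pow, monomial_mul,
      one_mul]
  rw [hmon, contract_monomial_left]
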